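/- There is an absolute constant $C > 0$ such that the following holds for all integers $k \ge 2$ and $n_1 \ge \dots \ge n_k \ge 1$. Consider a finite set $G$ of indivisible goods and $k$ groups of agents, where group $i$ has $n_i$ agents and the $j$-th agent of group $i$ has a monotone additive utility function $u^{(i,j)}$, i.e. $u^{(i,j)}(S) = \sum_{g \in S} u^{(i,j)}(g)$ for all $S \subseteq G$, with $u^{(i,j)}(g) \ge 0$ for all $g \in G$. An allocation is a partition $(A_1, \dots, A_k)$ of $G$ into $k$ (possibly empty) bundles, $A_i$ being given to group $i$. It is $\mathrm{PROP}c$ (proportional up to $c$ goods) if for every $i \in \{1,\dots,k\}$ and $j \in \{1,\dots,n_i\}$ there is a set $B \subseteq G \setminus A_i$ with $|B| \le c$ and $u^{(i,j)}(A_i) \ge u^{(i,j)}(G)/k - u^{(i,j)}(B)$. Let $c^{\mathrm{PROP}}(n_1, \dots, n_k)$ be the smallest nonnegative integer $c$ such that, for every finite $G$ and all such utility functions, a $\mathrm{PROP}c$ allocation exists. Then $c^{\mathrm{PROP}}(n_1,\dots,n_k)$ exists (is finite) and $$c^{\mathrm{PROP}}(n_1, \dots, n_k) \le C \sqrt{n_1}.$$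 -/

import Mathlib

namespace GroupFairDivision

/-- The additive utility of a bundle `S` for an agent whose value for the single good `g`
is `v g`. -/
def bundleUtility {G : Type} (v : G → ℝ) (S : Finset G) : ℝ :=
  ∑ g ∈ S, v g

/-- An allocation of the goods `G` to `k` groups: a partition of `G` into `k` (possibly empty)
bundles, `bundle i` being given to group `i`. -/
structure Allocation (k : ℕ) (G : Type) where
  bundle : Fin k → Finset G
  disjoint : ∀ i j : Fin k, i ≠ j → Disjoint (bundle i) (bundle j)
  cover : ∀ g : G, ∃ i : Fin k, g ∈ bundle i

/-- The allocation `A` is proportional up to `c` goods (PROP`c`), where `u i j` is the utility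
function of the `j`-th agent of group `i`: every agent of every group `i` has a set `B` of at most
`c` goods outside her group's bundle such that `u(A_i) ≥ u(G) / k - u(B)`. -/
def Allocation.IsPROP {k : ℕ} {G : Type} [Fintype G] {n : Fin k → ℕ}
    (A : Allocation k G) (u : (i : Fin k) → Fin (n i) → G → ℝ) (c : ℕ) : Prop :=
  ∀ (i : Fin k) (j : Fin (n i)), ∃ B : Finset G,
    (∀ g ∈ B, g ∉ A.bundle i) ∧ B.card ≤ c ∧
      bundleUtility (u i j) (A.bundle i) ≥
        bundleUtility (u i j) Finset.univ / (k : ℝ) - bundleUtility (u i j) B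

/-- For `k` groups of sizes `n 0, …, n (k - 1)`, a PROP`c` allocation always exists: for every
finite set `G` of goods and all monotone (nonnegative) additive utilities of the agents. -/
def PROPAlwaysExists {k : ℕ} (n : Fin k → ℕ) (c : ℕ) : Prop :=
  ∀ (G : Type) [Fintype G] (u : (i : Fin k) → Fin (n i) → G → ℝ),
    (∀ i j g, 0 ≤ u i j g) → ∃ A : Allocation k G, A.IsPROP u c

/-- The smallest `c` such that a PROP`c` allocation always exists. (If there were no such `c`, the
value would be `0`, and `PROPAlwaysExists n (cPROP n)` would then fail.) -/
noncomputable def cPROP {k : ℕ} (n : Fin k → ℕ) : ℕ :=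
  sInf {c : ℕ | PROPAlwaysExists n c}

end GroupFairDivision

/-! Discrepancy: for N linear forms with coefficients in [-1, 1], the constant vector q rounds to a
0/1 vector with error O(√N) in every form. Linear algebra first leaves at most N fractional
coordinates. From m of them, maximise the sum of squares minus a quartic penalty on the deviations:
a maximiser that is still half fractional would violate second-order optimality, averaged over an
orthonormal family (`exists_two_mul_card_fracSupport_le`). The errors (mN)^(1/4) decay geometrically
as m halves.

Division: halve the set of groups recursively, splitting the goods in proportion for all agents
involved. With s groups left the error per final share is O(√(sM)/s), M being the largest group
size; these sum to O(√M) whatever k is (`exists_assignment`).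

Large goods: each agent sets aside her t most valuable goods, whose least value τ bounds all the
others. The error on the rest is O(τ√M), paid for by half the value of the goods set aside once t is
of order √M. -/

namespace GroupFairDivision

open Finset Filter Topology

/-! ### Second-order optimality on the rounding polytope -/

section Rounding

variable {R G : Type*} [Fintype G]

/-- The coordinates at which `x` is strictly between `0` and `1`. -/
noncomputable def fracSupport (x : G → ℝ) : Finset G :=
  {g | 0 < x g ∧ x g < 1}

theorem mem_fracSupport {x : G → ℝ} {g : G} : g ∈ fracSupport x ↔ 0 < x g ∧ x g < 1 := by
  simp [fracSupport]

/-- The points of the cube that agree with `x` where `x` is integral, and at which every linear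
form `a r` deviates by at most `b` from its value at `x`. -/
def roundingPolytope (a : R → G → ℝ) (x : G → ℝ) (b : ℝ) : Set (G → ℝ) :=
  {y | (∀ g, 0 ≤ y g ∧ y g ≤ 1) ∧ (∀ g, g ∉ fracSupport x → y g = x g) ∧
    ∀ r, |∑ g, a r g * (y g - x g)| ≤ b}

theorem isCompact_roundingPolytope (a : R → G → ℝ) (x : G → ℝ) (b : ℝ) :
    IsCompact (roundingPolytope a x b) := by
  have hcube : IsCompact (Set.pi Set.univ fun _ : G => Set.Icc (0 : ℝ) 1) :=
    isCompact_univ_pi fun _ => isCompact_Icc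
  refine hcube.of_isClosed_subset ?_ fun y hy g _ => hy.1 g
  have heq : roundingPolytope a x b = (⋂ g, {y | 0 ≤ y g ∧ y g ≤ 1}) ∩
      ((⋂ g, ⋂ (_ : g ∉ fracSupport x), {y | y g = x g}) ∩
        ⋂ r, {y | |∑ g, a r g * (y g - x g)| ≤ b}) := by
    ext y
    simp [roundingPolytope]
  rw [heq]
  refine IsClosed.inter (isClosed_iInter fun g => ?_) (IsClosed.inter
    (isClosed_iInter fun g => isClosed_iInter fun _ => ?_) (isClosed_iInter fun r => ?_))
  · exact isClosed_Icc.preimage (continuous_apply g)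
  · exact isClosed_eq (continuous_apply g) continuous_const
  · exact isClosed_le (by fun_prop) continuous_const

/-- Slack constraints survive small moves by continuity; tight ones are unchanged along `v`. -/
theorem eventually_add_smul_mem_roundingPolytope [Finite R] {a : R → G → ℝ} {x y v : G → ℝ} {b : ℝ}
    (hy : y ∈ roundingPolytope a x b) (hv : ∀ g, g ∉ fracSupport y → v g = 0)
    (hvT : ∀ r, |∑ g, a r g * (y g - x g)| = b → ∑ g, a r g * v g = 0) :
    ∀ᶠ ε : ℝ in 𝓝 0, (fun g => y g + ε * v g) ∈ roundingPolytope a x b := by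
  have hdev (ε : ℝ) (r : R) : ∑ g, a r g * (y g + ε * v g - x g) =
      ∑ g, a r g * (y g - x g) + ε * ∑ g, a r g * v g := by
    rw [mul_sum, ← sum_add_distrib]
    exact sum_congr rfl fun g _ => by ring
  have hcube : ∀ᶠ ε : ℝ in 𝓝 0, ∀ g, 0 ≤ y g + ε * v g ∧ y g + ε * v g ≤ 1 := by
    refine eventually_all.2 fun g => ?_
    by_cases hg : g ∈ fracSupport y
    · have hc : Tendsto (fun ε : ℝ => y g + ε * v g) (𝓝 0) (𝓝 (y g)) := by
        have : Continuous fun ε : ℝ => y g + ε * v g := by fun_prop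
        simpa using this.tendsto 0
      obtain ⟨h0, h1⟩ := mem_fracSupport.1 hg
      filter_upwards [hc.eventually_const_lt h0, hc.eventually_lt_const h1] with ε h h'
      exact ⟨h.le, h'.le⟩
    · simp [hv g hg, hy.1 g]
  have hrow : ∀ᶠ ε : ℝ in 𝓝 0, ∀ r, |∑ g, a r g * (y g + ε * v g - x g)| ≤ b := by
    refine eventually_all.2 fun r => ?_
    simp only [hdev]
    rcases (hy.2.2 r).lt_or_eq with hr | hr
    · have hc : Tendsto (fun ε : ℝ => |∑ g, a r g * (y g - x g) + ε * ∑ g, a r g * v g|)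
          (𝓝 0) (𝓝 |∑ g, a r g * (y g - x g)|) := by
        have : Continuous fun ε : ℝ =>
          |∑ g, a r g * (y g - x g) + ε * ∑ g, a r g * v g| := by fun_prop
        simpa using this.tendsto 0
      filter_upwards [hc.eventually_lt_const hr] with ε h using h.le
    · simp [hvT r hr, hr]
  filter_upwards [hcube, hrow] with ε h1 h2
  refine ⟨h1, fun g hg => ?_, h2⟩
  have hyx := hy.2.1 g hg
  have : g ∉ fracSupport y := by
    rw [mem_fracSupport, hyx, ← mem_fracSupport]
    exact hg
  simp [hv g this, hyx]

/-- The objective maximised in the rounding argument. -/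
def roundingObjective [Fintype R] (a : R → G → ℝ) (x : G → ℝ) (c : ℝ) (y : G → ℝ) : ℝ :=
  ∑ g, y g ^ 2 - c * ∑ r, (∑ g, a r g * (y g - x g)) ^ 4

theorem exists_isMaxOn_roundingObjective [Fintype R] (a : R → G → ℝ) {x : G → ℝ}
    (hx : ∀ g, 0 ≤ x g ∧ x g ≤ 1) {b : ℝ} (hb : 0 ≤ b) (c : ℝ) :
    ∃ y ∈ roundingPolytope a x b,
      IsMaxOn (roundingObjective a x c) (roundingPolytope a x b) y := by
  refine (isCompact_roundingPolytope a x b).exists_isMaxOn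
    ⟨x, hx, fun _ _ => rfl, fun r => by simpa using hb⟩ ?_
  unfold roundingObjective
  fun_prop

/-- The second-order optimality condition for the rounding objective. -/
theorem sum_sq_le_of_isMaxOn_roundingObjective [Fintype R] {a : R → G → ℝ} {x y v : G → ℝ}
    {b c : ℝ} (hy : y ∈ roundingPolytope a x b)
    (hmax : IsMaxOn (roundingObjective a x c) (roundingPolytope a x b) y)
    (hv : ∀ g, g ∉ fracSupport y → v g = 0)
    (hvT : ∀ r, |∑ g, a r g * (y g - x g)| = b → ∑ g, a r g * v g = 0) :
    ∑ g, v g ^ 2 ≤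
      6 * c * ∑ r, (∑ g, a r g * (y g - x g)) ^ 2 * (∑ g, a r g * v g) ^ 2 := by
  set p : R → ℝ := fun r => ∑ g, a r g * (y g - x g) with hp
  set d : R → ℝ := fun r => ∑ g, a r g * v g with hd
  have hdev (ε : ℝ) (r : R) : ∑ g, a r g * (y g + ε * v g - x g) = p r + ε * d r := by
    rw [hp, hd]
    simp only [mul_sum]
    rw [← sum_add_distrib]
    exact sum_congr rfl fun g _ => by ring
  have hobj (ε : ℝ) : roundingObjective a x c (fun g => y g + ε * v g) =
      ∑ g, (y g + ε * v g) ^ 2 - c * ∑ r, (p r + ε * d r) ^ 4 := by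
    simp only [roundingObjective, hdev]
  have hsecond (ε : ℝ) : roundingObjective a x c (fun g => y g + ε * v g) +
      roundingObjective a x c (fun g => y g + (-ε) * v g) - 2 * roundingObjective a x c y =
      2 * ε ^ 2 * (∑ g, v g ^ 2 -
        (6 * c * ∑ r, p r ^ 2 * d r ^ 2 + ε ^ 2 * (c * ∑ r, d r ^ 4))) := by
    have h0 : roundingObjective a x c y = ∑ g, y g ^ 2 - c * ∑ r, p r ^ 4 := rfl
    have h1 : ∑ g, (y g + ε * v g) ^ 2 + ∑ g, (y g + (-ε) * v g) ^ 2 =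
        2 * ∑ g, y g ^ 2 + 2 * ε ^ 2 * ∑ g, v g ^ 2 := by
      simp only [mul_sum, ← sum_add_distrib]
      exact sum_congr rfl fun g _ => by ring
    have h2 : ∑ r, (p r + ε * d r) ^ 4 + ∑ r, (p r + (-ε) * d r) ^ 4 =
        2 * ∑ r, p r ^ 4 + 12 * ε ^ 2 * ∑ r, p r ^ 2 * d r ^ 2 + 2 * ε ^ 4 * ∑ r, d r ^ 4 := by
      simp only [mul_sum, ← sum_add_distrib]
      exact sum_congr rfl fun g _ => by ring
    rw [hobj, hobj, h0]
    linear_combination h1 - c * h2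
  have hplus := eventually_add_smul_mem_roundingPolytope hy hv hvT
  have hminus : ∀ᶠ ε : ℝ in 𝓝 0, (fun g => y g + (-ε) * v g) ∈ roundingPolytope a x b := by
    have : Tendsto (fun ε : ℝ => -ε) (𝓝 0) (𝓝 0) := by simpa using (continuous_neg (G := ℝ)).tendsto 0
    exact this.eventually hplus
  have hle : ∀ᶠ ε : ℝ in 𝓝[≠] 0, ∑ g, v g ^ 2 ≤
      6 * c * ∑ r, p r ^ 2 * d r ^ 2 + ε ^ 2 * (c * ∑ r, d r ^ 4) := by
    filter_upwards [hplus.filter_mono nhdsWithin_le_nhds, hminus.filter_mono nhdsWithin_le_nhds,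
      self_mem_nhdsWithin] with ε h1 h2 h3
    have h4 := hmax h1
    have h5 := hmax h2
    have h6 := hsecond ε
    have hε : 0 < 2 * ε ^ 2 := by
      have : ε ≠ 0 := h3
      positivity
    by_contra! hcon
    have := mul_pos hε (sub_pos.2 hcon)
    simp only [Set.mem_ofPred_eq] at h4 h5
    linarith
  have hlim : Tendsto (fun ε : ℝ => 6 * c * ∑ r, p r ^ 2 * d r ^ 2 + ε ^ 2 * (c * ∑ r, d r ^ 4))
      (𝓝[≠] 0) (𝓝 (6 * c * ∑ r, p r ^ 2 * d r ^ 2)) := by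
    have : Continuous fun ε : ℝ =>
      6 * c * ∑ r, p r ^ 2 * d r ^ 2 + ε ^ 2 * (c * ∑ r, d r ^ 4) := by fun_prop
    simpa using (this.tendsto 0).mono_left nhdsWithin_le_nhds
  exact ge_of_tendsto hlim hle

/-- An orthonormal family of vectors supported on `F` and orthogonal to the forms in `T`. -/
theorem exists_orthonormal_family (a : R → G → ℝ) (ha : ∀ r g, |a r g| ≤ 1)
    (F : Finset G) (T : Finset R) :
    ∃ (d : ℕ) (v : Fin d → G → ℝ), F.card ≤ d + T.card ∧
      (∀ i g, g ∉ F → v i g = 0) ∧ (∀ i, ∑ g, v i g ^ 2 = 1) ∧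
      (∀ i, ∀ r ∈ T, ∑ g, a r g * v i g = 0) ∧
      ∀ r, ∑ i, (∑ g, a r g * v i g) ^ 2 ≤ F.card := by
  classical
  let row (r : R) : EuclideanSpace ℝ F := WithLp.toLp 2 fun g => a r g
  let L : EuclideanSpace ℝ F →ₗ[ℝ] (T → ℝ) :=
    LinearMap.pi fun r => (innerSL ℝ (row r)).toLinearMap
  let B := stdOrthonormalBasis ℝ (LinearMap.ker L)
  let v (i : Fin (Module.finrank ℝ (LinearMap.ker L))) (g : G) : ℝ :=
    if h : g ∈ F then (B i : EuclideanSpace ℝ F) ⟨g, h⟩ else 0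
  have hsum (f : G → ℝ → ℝ) (hf : ∀ g, f g 0 = 0) (i) :
      ∑ g, f g (v i g) = ∑ g : F, f g ((B i : EuclideanSpace ℝ F) g) := by
    rw [← sum_subset (subset_univ F) fun g _ hg => by simp [v, hg, hf], ← sum_coe_sort F]
    exact sum_congr rfl fun g _ => by simp [v]
  have hrow (i) (r : R) : ∑ g, a r g * v i g = inner ℝ (B i : EuclideanSpace ℝ F) (row r) := by
    rw [hsum (fun g t => a r g * t) (by simp) i, PiLp.inner_apply]
    simp [row]
  have hB : Orthonormal ℝ fun i => (B i : EuclideanSpace ℝ F) :=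
    B.orthonormal.comp_linearIsometry (LinearMap.ker L).subtypeₗᵢ
  refine ⟨_, v, ?_, fun i g hg => by simp [v, hg], fun i => ?_, fun i r hr => ?_, fun r => ?_⟩
  · have h1 := L.finrank_range_add_finrank_ker
    have h2 := Submodule.finrank_le (LinearMap.range L)
    simp only [Module.finrank_fintype_fun_eq_card, Fintype.card_coe,
      finrank_euclideanSpace] at h1 h2
    omega
  · rw [hsum (fun _ t => t ^ 2) (by simp) i]
    have := hB.1 i
    rw [← sq_eq_sq₀ (norm_nonneg _) zero_le_one, EuclideanSpace.norm_sq_eq] at this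
    simpa using this
  · have := (B i).2
    rw [LinearMap.mem_ker] at this
    rw [hrow, real_inner_comm]
    exact congrFun this ⟨r, hr⟩
  -- Bessel's inequality for the row restricted to `F`.
  · have h1 := hB.sum_inner_products_le (x := row r) (s := univ)
    have h2 : ‖row r‖ ^ 2 ≤ F.card := by
      rw [EuclideanSpace.norm_sq_eq]
      calc ∑ g : F, ‖row r g‖ ^ 2 ≤ ∑ _g : F, (1 : ℝ) :=
            sum_le_sum fun g _ => pow_le_one₀ (norm_nonneg _) (ha r g)
        _ = F.card := by simp
    simp only [hrow]
    simp only [Real.norm_eq_abs, sq_abs] at h1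
    exact h1.trans h2

end Rounding

end GroupFairDivision

namespace GroupFairDivision

open Finset Filter Topology

/-! ### Halving the fractional support; linear discrepancy -/

section Rounding

variable {R G : Type*} [Fintype G]

theorem fracSupport_subset_of_mem_roundingPolytope {a : R → G → ℝ} {x y : G → ℝ} {b : ℝ}
    (hy : y ∈ roundingPolytope a x b) : fracSupport y ⊆ fracSupport x := by
  intro g hg
  by_contra h
  rw [mem_fracSupport, hy.2.1 g h, ← mem_fracSupport] at hg
  exact h hg

variable [Fintype R]

/-- Any point of the cube can be moved, without changing `N` linear forms, to a point with at most
`N` fractional coordinates. -/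
theorem exists_card_fracSupport_le_card {a : R → G → ℝ} (ha : ∀ r g, |a r g| ≤ 1) {x : G → ℝ}
    (hx : ∀ g, 0 ≤ x g ∧ x g ≤ 1) :
    ∃ y : G → ℝ, (∀ g, 0 ≤ y g ∧ y g ≤ 1) ∧ (∀ r, ∑ g, a r g * (y g - x g) = 0) ∧
      (fracSupport y).card ≤ Fintype.card R := by
  -- With `b = c = 0` every form is frozen and the objective is convex, so a nonzero free direction
  -- would give `1 ≤ 0`.
  obtain ⟨y, hy, hmax⟩ := exists_isMaxOn_roundingObjective a hx le_rfl 0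
  refine ⟨y, hy.1, fun r => abs_nonpos_iff.1 (hy.2.2 r), ?_⟩
  obtain ⟨d, v, hd, hv, hv1, hvT, -⟩ := exists_orthonormal_family a ha (fracSupport y) univ
  rcases Nat.eq_zero_or_pos d with rfl | hpos
  · simpa using hd
  · have := sum_sq_le_of_isMaxOn_roundingObjective hy hmax (hv ⟨0, hpos⟩)
      fun r _ => hvT ⟨0, hpos⟩ r (mem_univ r)
    rw [hv1] at this
    norm_num at this

/-- At least half of the fractional coordinates of a point of the cube can be rounded. -/
theorem exists_two_mul_card_fracSupport_le [Nonempty R] {a : R → G → ℝ} (ha : ∀ r g, |a r g| ≤ 1)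
    {x : G → ℝ} (hx : ∀ g, 0 ≤ x g ∧ x g ≤ 1) (hm : 0 < (fracSupport x).card) :
    ∃ y : G → ℝ, (∀ g, 0 ≤ y g ∧ y g ≤ 1) ∧
      (∀ r, |∑ g, a r g * (y g - x g)| ≤ 7 * √√((fracSupport x).card * Fintype.card R)) ∧
      2 * (fracSupport y).card ≤ (fracSupport x).card := by
  classical
  set m := (fracSupport x).card with hmdef
  set N := Fintype.card R with hN
  have hm0 : (0 : ℝ) < m := by exact_mod_cast hm
  have hN0 : (0 : ℝ) < N := by exact_mod_cast Fintype.card_pos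
  set b : ℝ := 7 * √√(m * N) with hb
  have hb0 : 0 < b := by positivity
  have hb4 : b ^ 4 = 2401 * (m * N) := by
    have : √√((m : ℝ) * N) ^ 4 = m * N := by
      rw [show 4 = 2 * 2 from rfl, pow_mul, Real.sq_sqrt (by positivity),
        Real.sq_sqrt (by positivity)]
    rw [hb, mul_pow, this]
    norm_num
  -- With `c * b ^ 4 = 4`, at most `m / 4` forms can be tight, leaving more than `m / 4` free
  -- directions if over half of the coordinates stay fractional.
  set c : ℝ := 4 / b ^ 4 with hc
  have hc0 : 0 < c := by positivity
  have hcb : c * b ^ 4 = 4 := div_mul_cancel₀ _ (by positivity)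
  obtain ⟨y, hy, hmax⟩ := exists_isMaxOn_roundingObjective a hx hb0.le c
  refine ⟨y, hy.1, hy.2.2, ?_⟩
  set p : R → ℝ := fun r => ∑ g, a r g * (y g - x g) with hp
  have hquartic : c * ∑ r, p r ^ 4 ≤ m := by
    have h1 := hmax (show x ∈ roundingPolytope a x b from
      ⟨hx, fun _ _ => rfl, fun r => by simpa using hb0.le⟩)
    have h2 : ∑ g, y g ^ 2 - ∑ g, x g ^ 2 ≤ m := by
      rw [← sum_sub_distrib, ← sum_subset (subset_univ (fracSupport x))
        fun g _ hg => by rw [hy.2.1 g hg, sub_self]]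
      calc ∑ g ∈ fracSupport x, (y g ^ 2 - x g ^ 2) ≤ ∑ g ∈ fracSupport x, (1 : ℝ) :=
            sum_le_sum fun g _ => by nlinarith [hy.1 g, sq_nonneg (x g)]
        _ = m := by simp [hmdef]
    simp only [roundingObjective, Set.mem_ofPred_eq, sub_self, mul_zero, sum_const_zero,
      ne_eq, OfNat.ofNat_ne_zero, not_false_eq_true, zero_pow, sub_zero] at h1
    linarith
  by_contra! hF
  set T : Finset R := {r | |p r| = b} with hT
  have hTcard : 4 * T.card ≤ m := by
    have h1 : T.card * b ^ 4 ≤ ∑ r, p r ^ 4 := by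
      calc T.card * b ^ 4 = ∑ r ∈ T, p r ^ 4 := by
            rw [← nsmul_eq_mul, ← sum_const]
            refine sum_congr rfl fun r hr => ?_
            rw [← (mem_filter.1 hr).2, Even.pow_abs (by decide)]
        _ ≤ ∑ r, p r ^ 4 := sum_le_univ_sum_of_nonneg fun r => by positivity
    have h2 := mul_le_mul_of_nonneg_left h1 hc0.le
    have h3 : (4 * T.card : ℝ) ≤ m := by nlinarith
    exact_mod_cast h3
  obtain ⟨d, v, hd, hv, hv1, hvT, hvsum⟩ := exists_orthonormal_family a ha (fracSupport y) T
  have hFm : (fracSupport y).card ≤ m :=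
    card_le_card (fracSupport_subset_of_mem_roundingPolytope hy)
  have hdm : (m : ℝ) < 4 * d := by
    have : m < 4 * d := by omega
    exact_mod_cast this
  have htrace : (d : ℝ) ≤ 6 * c * (m * ∑ r, p r ^ 2) := by
    calc (d : ℝ) = ∑ i, ∑ g, v i g ^ 2 := by simp [hv1]
      _ ≤ ∑ i, 6 * c * ∑ r, p r ^ 2 * (∑ g, a r g * v i g) ^ 2 :=
          sum_le_sum fun i _ => sum_sq_le_of_isMaxOn_roundingObjective hy hmax (hv i)
            fun r hr => hvT i r (mem_filter.2 ⟨mem_univ r, hr⟩)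
      _ = 6 * c * ∑ r, p r ^ 2 * ∑ i, (∑ g, a r g * v i g) ^ 2 := by
          rw [← mul_sum, sum_comm]
          simp only [mul_sum]
      _ ≤ 6 * c * (m * ∑ r, p r ^ 2) := by
          rw [mul_sum univ _ (m : ℝ)]
          refine mul_le_mul_of_nonneg_left (sum_le_sum fun r _ => ?_) (by positivity)
          rw [mul_comm]
          refine mul_le_mul_of_nonneg_right ((hvsum r).trans ?_) (sq_nonneg _)
          exact_mod_cast hFm
  have hquad : (∑ r, p r ^ 2) ^ 2 ≤ N * ∑ r, p r ^ 4 := by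
    have := sq_sum_le_card_mul_sum_sq (s := (univ : Finset R)) (f := fun r => p r ^ 2)
    simpa [← pow_mul, ← hN] using this
  set S := ∑ r, p r ^ 2 with hS
  have h1 : 1 < 24 * c * S := by
    have : m * 1 < m * (24 * c * S) := by linarith
    exact lt_of_mul_lt_mul_left this hm0.le
  have h2 : 1 < 576 * c ^ 2 * S ^ 2 := by nlinarith
  have h3 : 576 * c ^ 2 * S ^ 2 ≤ 576 * c * (N * m) := by
    calc 576 * c ^ 2 * S ^ 2 ≤ 576 * c ^ 2 * (N * ∑ r, p r ^ 4) := by gcongr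
      _ = 576 * c * (N * (c * ∑ r, p r ^ 4)) := by ring
      _ ≤ 576 * c * (N * m) := by gcongr
  -- Now `576 * c * (N * m) = 2304 / 2401 < 1`, a contradiction.
  rw [hb4] at hcb
  linarith

theorem exists_integral_of_card_fracSupport_le [Nonempty R] {a : R → G → ℝ}
    (ha : ∀ r g, |a r g| ≤ 1) (m : ℕ) {x : G → ℝ} (hx : ∀ g, 0 ≤ x g ∧ x g ≤ 1)
    (hm : (fracSupport x).card ≤ m) :
    ∃ y : G → ℝ, (∀ g, y g = 0 ∨ y g = 1) ∧
      ∀ r, |∑ g, a r g * (y g - x g)| ≤ 47 * √√(m * Fintype.card R) := by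
  induction m using Nat.strong_induction_on generalizing x with
  | _ m ih =>
    rcases Nat.eq_zero_or_pos (fracSupport x).card with h0 | hpos
    · refine ⟨x, fun g => ?_, fun r => by simp; positivity⟩
      have hg : g ∉ fracSupport x := by simp [card_eq_zero.1 h0]
      rw [mem_fracSupport, not_and_or, not_lt, not_lt] at hg
      exact hg.imp (fun h => le_antisymm h (hx g).1) fun h => le_antisymm (hx g).2 h
    · obtain ⟨y, hy, hyx, hcard⟩ := exists_two_mul_card_fracSupport_le ha hx hpos
      obtain ⟨z, hz, hzy⟩ := ih (fracSupport y).card (by omega) hy le_rfl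
      refine ⟨z, hz, fun r => ?_⟩
      have hsplit : ∑ g, a r g * (z g - x g) =
          ∑ g, a r g * (z g - y g) + ∑ g, a r g * (y g - x g) := by
        rw [← sum_add_distrib]
        exact sum_congr rfl fun g _ => by ring
      have hpow (t : ℝ) (ht : 0 ≤ t) : √√t ^ 4 = t := by
        rw [show 4 = 2 * 2 from rfl, pow_mul, Real.sq_sqrt (by positivity), Real.sq_sqrt ht]
      have hmono : √√((fracSupport x).card * Fintype.card R : ℝ) ≤ √√(m * Fintype.card R) := by
        gcongr
      -- `(17/20)^4 > 1/2`, and the induction closes because `7 + 47 * 17/20 < 47`.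
      have hhalf : √√((fracSupport y).card * Fintype.card R : ℝ) ≤
          17 / 20 * √√(m * Fintype.card R) := by
        rw [← pow_le_pow_iff_left₀ (by positivity) (by positivity) four_ne_zero, mul_pow,
          hpow _ (by positivity), hpow _ (by positivity)]
        have h1 : (2 * (fracSupport y).card : ℝ) ≤ m := by exact_mod_cast hcard.trans hm
        have h2 := mul_le_mul_of_nonneg_right h1 (Nat.cast_nonneg (α := ℝ) (Fintype.card R))
        have h3 : (0 : ℝ) ≤ m * Fintype.card R := by positivity
        norm_num
        linarith
      rw [hsplit]
      have h4 := abs_add_le (∑ g, a r g * (z g - y g)) (∑ g, a r g * (y g - x g))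
      have h5 := hzy r
      have h6 := hyx r
      have h7 := Real.sqrt_nonneg (√(m * Fintype.card R : ℝ))
      linarith

/-- Linear discrepancy of `N` forms with coefficients in `[-1, 1]` is `O(√N)`. -/
theorem exists_finset_abs_sum_sub_le {a : R → G → ℝ} (ha : ∀ r g, |a r g| ≤ 1) {q : ℝ}
    (hq0 : 0 ≤ q) (hq1 : q ≤ 1) :
    ∃ Y : Finset G, ∀ r, |∑ g ∈ Y, a r g - q * ∑ g, a r g| ≤ 47 * √(Fintype.card R) := by
  classical
  cases isEmpty_or_nonempty R with
  | inl h => exact ⟨∅, fun r => h.elim r⟩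
  | inr h =>
    obtain ⟨y, hy, hyx, hcard⟩ :=
      exists_card_fracSupport_le_card ha (x := fun _ => q) fun _ => ⟨hq0, hq1⟩
    obtain ⟨z, hz, hzy⟩ := exists_integral_of_card_fracSupport_le ha _ hy hcard
    refine ⟨univ.filter fun g => z g = 1, fun r => ?_⟩
    have hsum : ∑ g with z g = 1, a r g - q * ∑ g, a r g = ∑ g, a r g * (z g - y g) := by
      have h1 : ∑ g with z g = 1, a r g = ∑ g, a r g * z g := by
        rw [sum_filter]
        refine sum_congr rfl fun g _ => ?_
        rcases hz g with h | h <;> simp [h]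
      have h2 := hyx r
      simp only [mul_sub, sum_sub_distrib, ← sum_mul] at h2 ⊢
      rw [h1]
      linarith
    rw [hsum]
    have := hzy r
    rwa [Real.sqrt_mul_self (Nat.cast_nonneg _)] at this

end Rounding

end GroupFairDivision

namespace GroupFairDivision

open Finset

/-! ### Recursive division among groups -/

section Groups

/-- The bound `705 * (1 - 1 / √s)` is a potential whose increase from `t` to `s` absorbs the error
of one split; `705 = 47 * 15`. -/
theorem split_error_le {s t : ℝ} (ht : 0 < t) (h1 : s ≤ 3 * t) (h2 : 3 * t ≤ 2 * s) :
    47 * √s / t + 705 * (1 - 1 / √t) ≤ 705 * (1 - 1 / √s) := by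
  have hs : 0 < s := by linarith
  have hp : 0 < √s := Real.sqrt_pos.2 hs
  have hq : 0 < √t := Real.sqrt_pos.2 ht
  have hps := Real.sq_sqrt hs.le
  have hqt := Real.sq_sqrt ht.le
  set p := √s
  set q := √t
  have hlow : p ≤ 2 * q := by
    refine (sq_le_sq₀ (by positivity) (by positivity)).1 ?_
    nlinarith
  have hupp : 6 * q ≤ 5 * p := by
    refine (sq_le_sq₀ (by positivity) (by positivity)).1 ?_
    nlinarith
  have hkey : p ^ 2 ≤ 15 * (q * (p - q)) := by
    have h3 : p * p ≤ 2 * q * p := mul_le_mul_of_nonneg_right hlow hp.le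
    have h4 : q * (6 * q) ≤ q * (5 * p) := mul_le_mul_of_nonneg_left hupp hq.le
    nlinarith
  have heq : 705 * (1 - 1 / p) - (47 * p / t + 705 * (1 - 1 / q)) =
      47 * (15 * (q * (p - q)) - p ^ 2) / (q ^ 2 * p) := by
    rw [← hqt]
    field_simp
    ring
  have : 0 ≤ 47 * (15 * (q * (p - q)) - p ^ 2) / (q ^ 2 * p) :=
    div_nonneg (by linarith) (by positivity)
  linarith

/-- The goods in `X` can be assigned to the groups in `S` in such a way that every agent with values
in `[0, 1]` gets her proportional share up to an error `O(√M)`, where `M` bounds the sizes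
of the groups. -/
theorem exists_assignment {I G : Type*} [DecidableEq I] [Fintype G] {n : I → ℕ} {M : ℕ}
    (hn : ∀ i, n i ≤ M) (w : (i : I) → Fin (n i) → G → ℝ)
    (hw : ∀ i j g, 0 ≤ w i j g ∧ w i j g ≤ 1) (s : ℕ) (S : Finset I) (hS : S.card = s)
    (hs : 0 < s) (X : Finset G) :
    ∃ f : G → I, (∀ g, f g ∈ S) ∧ ∀ i ∈ S, ∀ j,
      (∑ g ∈ X, w i j g) / s - 705 * (1 - 1 / √s) * √M ≤ ∑ g ∈ X with f g = i, w i j g := by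
  classical
  induction s using Nat.strong_induction_on generalizing S X with
  | _ s ih =>
    rcases Nat.lt_or_ge s 2 with h2 | h2
    · obtain rfl : s = 1 := by omega
      obtain ⟨i, rfl⟩ := card_eq_one.1 hS
      refine ⟨fun _ => i, by simp, fun i' hi' j => ?_⟩
      obtain rfl := mem_singleton.1 hi'
      simp
    · obtain ⟨S₁, hS₁, hc₁⟩ := exists_subset_card_eq (s := S) (n := s / 2) (by omega)
      have hc₂ : (S \ S₁).card = s - s / 2 := by rw [card_sdiff_of_subset hS₁, hS, hc₁]
      set s₁ := s / 2
      set s₂ := s - s / 2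
      have hs0 : (0 : ℝ) < s := by exact_mod_cast hs
      have hsum : (s₁ + s₂ : ℝ) = s := by
        have : s₁ + s₂ = s := by omega
        exact_mod_cast this
      have hs₁ : 0 < s₁ := by omega
      have hs₂ : 0 < s₂ := by omega
      have hs₁' : (0 : ℝ) < s₁ := by exact_mod_cast hs₁
      have hs₂' : (0 : ℝ) < s₂ := by exact_mod_cast hs₂
      let a : (Σ i : S, Fin (n i)) → G → ℝ := fun r g => if g ∈ X then w r.1 r.2 g else 0
      have ha (r g) : |a r g| ≤ 1 := by
        by_cases hg : g ∈ X
        · simp only [a, hg, if_true]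
          exact abs_le.2 ⟨by linarith [(hw r.1 r.2 g).1], (hw r.1 r.2 g).2⟩
        · simp [a, hg]
      obtain ⟨Y, hY⟩ := exists_finset_abs_sum_sub_le ha (q := s₁ / s) (by positivity)
        ((div_le_one hs0).2 (by linarith))
      have hcard : √(Fintype.card (Σ i : S, Fin (n i)) : ℝ) ≤ √s * √M := by
        rw [← Real.sqrt_mul (Nat.cast_nonneg s)]
        refine Real.sqrt_le_sqrt ?_
        have : Fintype.card (Σ i : S, Fin (n i)) ≤ s * M := by
          rw [Fintype.card_sigma]
          calc ∑ i : S, Fintype.card (Fin (n i)) ≤ ∑ _i : S, M :=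
                sum_le_sum fun i _ => by simpa using hn i
            _ = s * M := by simp [hS]
        exact_mod_cast this
      have hY' : ∀ i ∈ S, ∀ j, |∑ g ∈ X ∩ Y, w i j g - s₁ / s * ∑ g ∈ X, w i j g| ≤
          47 * (√s * √M) := by
        intro i hi j
        have h := hY ⟨⟨i, hi⟩, j⟩
        simp only [a, ← sum_filter, filter_mem_eq_inter, univ_inter] at h
        rw [inter_comm]
        exact h.trans (by linarith)
      -- Both halves `t` of `s ≥ 2` satisfy `s ≤ 3 * t ≤ 2 * s`, with equality cases at `s = 3`.
      have herr (t : ℕ) (W V : ℝ) (ht : (0 : ℝ) < t) (ht1 : s ≤ 3 * t) (ht2 : 3 * t ≤ 2 * s)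
          (hV : t / s * W - 47 * (√s * √M) ≤ V) :
          W / s - 705 * (1 - 1 / √s) * √M ≤ V / t - 705 * (1 - 1 / √t) * √M := by
        have h3 := split_error_le ht (by exact_mod_cast ht1) (by exact_mod_cast ht2 : 3 * (t : ℝ) ≤ 2 * s)
        have h4 := mul_le_mul_of_nonneg_right h3 (Real.sqrt_nonneg (M : ℝ))
        have h5 := div_le_div_of_nonneg_right hV ht.le
        have h6 : (t / s * W - 47 * (√s * √M)) / t = W / s - 47 * √s / t * √M := by
          field_simp
        rw [h6] at h5
        linarith
      obtain ⟨f₁, hf₁, hA₁⟩ := ih s₁ (by omega) S₁ hc₁ hs₁ (X ∩ Y)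
      obtain ⟨f₂, hf₂, hA₂⟩ := ih s₂ (by omega) (S \ S₁) hc₂ hs₂ (X \ Y)
      refine ⟨fun g => if g ∈ Y then f₁ g else f₂ g, fun g => ?_, fun i hi j => ?_⟩
      · dsimp only
        split_ifs
        · exact hS₁ (hf₁ g)
        · exact (mem_sdiff.1 (hf₂ g)).1
      · have habs := abs_le.1 (hY' i hi j)
        by_cases hi₁ : i ∈ S₁
        · have hset : {g ∈ X | (if g ∈ Y then f₁ g else f₂ g) = i} = {g ∈ X ∩ Y | f₁ g = i} := by
            ext g
            have : f₂ g ≠ i := fun h => (mem_sdiff.1 (hf₂ g)).2 (h ▸ hi₁)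
            by_cases hg : g ∈ Y <;> simp [hg, this]
          rw [hset]
          exact (herr s₁ _ _ hs₁' (by omega) (by omega) (by linarith [habs.1])).trans
            (hA₁ i hi₁ j)
        · have hset : {g ∈ X | (if g ∈ Y then f₁ g else f₂ g) = i} = {g ∈ X \ Y | f₂ g = i} := by
            ext g
            have : f₁ g ≠ i := fun h => hi₁ (h ▸ hf₁ g)
            by_cases hg : g ∈ Y <;> simp [hg, this]
          have hadd := sum_inter_add_sum_sdiff X Y (w i j)
          have hfrac : (s₂ / s : ℝ) = 1 - s₁ / s := by
            rw [eq_sub_iff_add_eq, ← add_div, add_comm, hsum, div_self hs0.ne']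
          rw [hset]
          refine (herr s₂ _ _ hs₂' (by omega) (by omega) ?_).trans
            (hA₂ i (mem_sdiff.2 ⟨hi, hi₁⟩) j)
          rw [hfrac]
          linarith [habs.2]

theorem exists_card_eq_forall_le {G : Type*} [Fintype G] (v : G → ℝ) (t : ℕ)
    (ht : t ≤ Fintype.card G) :
    ∃ T : Finset G, T.card = t ∧ ∀ g ∈ T, ∀ h, h ∉ T → v h ≤ v g := by
  classical
  induction t with
  | zero => exact ⟨∅, by simp⟩
  | succ t ih =>
    obtain ⟨T, hT, htop⟩ := ih (by omega)
    have hne : (Tᶜ).Nonempty := by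
      rw [← card_pos, card_compl]
      omega
    obtain ⟨m, hm, hmax⟩ := exists_max_image Tᶜ v hne
    rw [mem_compl] at hm
    refine ⟨insert m T, by rw [card_insert_of_notMem hm, hT], fun g hg h hh => ?_⟩
    rw [mem_insert, not_or] at hh
    rcases mem_insert.1 hg with rfl | hg
    · exact hmax h (mem_compl.2 hh.2)
    · exact htop g hg h hh.2

/-- The most valuable `t` goods of an agent, and her remaining values rescaled to `[0, 1]`. -/
theorem exists_top_goods {G : Type*} [Fintype G] {v : G → ℝ} (hv : ∀ g, 0 ≤ v g) {t : ℕ}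
    (ht : 0 < t) :
    ∃ (T : Finset G) (τ : ℝ) (w : G → ℝ), T.card ≤ t ∧ 0 ≤ τ ∧ (∀ g, 0 ≤ w g ∧ w g ≤ 1) ∧
      (∀ g ∈ T, w g = 0) ∧ (∀ g, g ∉ T → v g = τ * w g) ∧ t * τ ≤ ∑ g ∈ T, v g := by
  classical
  rcases Nat.lt_or_ge (Fintype.card G) t with hG | hG
  · exact ⟨univ, 0, 0, by simpa using hG.le, le_rfl, by simp, by simp, by simp,
      by simpa using sum_nonneg fun g _ => hv g⟩
  · obtain ⟨T, hT, htop⟩ := exists_card_eq_forall_le v t hG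
    obtain ⟨m, hm, hmin⟩ := exists_min_image T v (card_pos.1 (hT ▸ ht))
    refine ⟨T, v m, fun g => if g ∈ T then 0 else v g / v m, hT.le, hv m, fun g => ?_,
      fun g hg => by simp [hg], fun g hg => ?_, ?_⟩
    · by_cases hg : g ∈ T
      · simp [hg]
      · simp only [hg, if_false]
        exact ⟨div_nonneg (hv g) (hv m), div_le_one_of_le₀ (htop m hm g hg) (hv m)⟩
    · simp only [hg, if_false]
      -- If the least top value is `0`, all remaining goods are worthless.
      rcases (hv m).eq_or_lt' with h0 | hpos
      · have := htop m hm g hg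
        rw [h0, zero_mul]
        exact le_antisymm (h0 ▸ this) (hv g)
      · rw [mul_div_cancel₀ _ hpos.ne']
    · rw [← hT, ← nsmul_eq_mul]
      exact card_nsmul_le_sum T v (v m) hmin

theorem propAlwaysExists_of_le {k : ℕ} (hk : 2 ≤ k) {n : Fin k → ℕ} {M : ℕ}
    (hn : ∀ i, n i ≤ M) {t : ℕ} (ht : 0 < t) (htM : 1410 * √M ≤ t) : PROPAlwaysExists n t := by
  classical
  intro G _ u hu
  choose T τ w hTt hτ hw hwT hwc hsum using fun i j => exists_top_goods (hu i j) ht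
  have hk0 : (0 : ℝ) < k := by
    have : 0 < k := by omega
    exact_mod_cast this
  obtain ⟨f, -, hf⟩ := exists_assignment hn w hw k univ (by simp) (by omega) (univ : Finset G)
  refine ⟨⟨fun i => {g | f g = i}, fun i j hij => ?_, fun g => ⟨f g, by simp⟩⟩, fun i j => ?_⟩
  · rw [disjoint_left]
    intro g hg hg'
    exact hij ((mem_filter.1 hg).2.symm.trans (mem_filter.1 hg').2)
  · set A : Finset G := {g | f g = i} with hA
    -- With this `B`, the agent counts all of `T i j`, of which at most half is needed for its own
    -- share since `k ≥ 2`; the other half covers `705 * √M * τ`.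
    refine ⟨T i j \ A, fun g hg => (mem_sdiff.1 hg).2,
      (card_le_card sdiff_subset).trans (hTt i j), ?_⟩
    have hoff (S : Finset G) : ∑ g ∈ S \ T i j, u i j g = τ i j * ∑ g ∈ S, w i j g := by
      rw [← sum_inter_add_sum_sdiff S (T i j) (w i j),
        sum_eq_zero fun g hg => hwT i j g (mem_inter.1 hg).2, zero_add, mul_sum]
      exact sum_congr rfl fun g hg => hwc i j g (mem_sdiff.1 hg).2
    have hA₁ := sum_inter_add_sum_sdiff A (T i j) (u i j)
    have hT₁ := sum_inter_add_sum_sdiff (T i j) A (u i j)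
    have hU₁ := sum_sdiff (f := u i j) (subset_univ (T i j))
    rw [hoff] at hA₁ hU₁
    rw [inter_comm] at hT₁
    have hshare : (∑ g, w i j g) / k - 705 * √M ≤ ∑ g ∈ A, w i j g := by
      refine le_trans ?_ (hf i (mem_univ i) j)
      have : 0 ≤ 1 / √(k : ℝ) * √M := by positivity
      linarith
    have hscaled := mul_le_mul_of_nonneg_left hshare (hτ i j)
    have hM := mul_le_mul_of_nonneg_right htM (hτ i j)
    have hhalf : (∑ g ∈ T i j, u i j g) / k ≤ (∑ g ∈ T i j, u i j g) / 2 :=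
      div_le_div_of_nonneg_left (sum_nonneg fun g _ => hu i j g) two_pos (by exact_mod_cast hk)
    have hsum' := hsum i j
    simp only [bundleUtility]
    rw [ge_iff_le, ← hU₁, add_div, mul_div_assoc]
    linarith

end Groups

end GroupFairDivision

theorem mainTheorem3 :
    ∃ C : ℝ, 0 < C ∧
      ∀ (k : ℕ) (hk : 2 ≤ k) (n : Fin k → ℕ), (∀ i, 1 ≤ n i) → Antitone n →
        GroupFairDivision.PROPAlwaysExists n (GroupFairDivision.cPROP n) ∧
          (GroupFairDivision.cPROP n : ℝ) ≤ C * √(n ⟨0, by omega⟩ : ℝ) := by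
  -- The ceiling costs at most `1 ≤ √M` beyond `1410 * √M`.
  refine ⟨1411, by norm_num, fun k hk n hn hanti => ?_⟩
  set M := n ⟨0, by omega⟩ with hM
  have hM1 : (1 : ℝ) ≤ √M := Real.one_le_sqrt.2 (by exact_mod_cast hn _)
  have hprop : GroupFairDivision.PROPAlwaysExists n ⌈1410 * √(M : ℝ)⌉₊ :=
    GroupFairDivision.propAlwaysExists_of_le hk
      (M := M) (fun i => hanti (Fin.mk_le_of_le_val (Nat.zero_le i.1)))
      (Nat.ceil_pos.2 (by positivity)) (Nat.le_ceil _)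
  refine ⟨Nat.sInf_mem (s := {c | GroupFairDivision.PROPAlwaysExists n c}) ⟨_, hprop⟩, ?_⟩
  have h1 : (GroupFairDivision.cPROP n : ℝ) ≤ ⌈1410 * √(M : ℝ)⌉₊ := by
    exact_mod_cast Nat.sInf_le hprop
  have h2 := Nat.ceil_lt_add_one (a := 1410 * √(M : ℝ)) (by positivity)
  linarith
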